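/- Let $d\ge 2$ and $0<r\le \frac{\pi}{2}$. Let $\mathbb{S}^d$ be the unit sphere of $\mathbb{E}^{d+1}$ with the spherical (angular) distance $\mathrm{dist}_s$, and for $\mathbf{x}\in\mathbb{S}^d$, $X\subseteq\mathbb{S}^d$ put $\mathbf{B}_s^d[\mathbf{x},r]=\{\mathbf{y}\in\mathbb{S}^d : \mathrm{dist}_s(\mathbf{x},\mathbf{y})\le r\}$ and $\mathbf{B}_s^d[X,r]=\bigcap_{\mathbf{x}\in X}\mathbf{B}_s^d[\mathbf{x},r]$. A wide $r$-ball body is a set $\mathbf{B}_s^d[X,r]$, where $X\subseteq\mathbb{S}^d$ is non-empty and closed with spherical diameter $\sup\{\mathrm{dist}_s(\mathbf{x},\mathbf{y}) : \mathbf{x},\mathbf{y}\in X\}\le r$. The inradius $R_{\rm in}(\mathbf{K})$ is the radius of a largest closed spherical ball (of radius in $(0,\frac{\pi}{2}]$) contained in $\mathbf{K}$. Let $\mathbf{\Delta}_d(r)$ be the intersection of the $d+1$ closed balls of radius $r$ centred at the vertices of a regular spherical $d$-simplex of edge length $r$ in $\mathbb{S}^d$ (such simplices exist). Then $\mathbf{\Delta}_d(r)$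 is a wide $r$-ball body, every wide $r$-ball body has a largest inscribed ball, and every wide $r$-ball body $\mathbf{B}_s^d[X,r]$ satisfies $$R_{\rm in}(\mathbf{B}_s^d[X,r])\ \ge\ R_{\rm in}(\mathbf{\Delta}_d(r)).$$ -/

import Mathlib

namespace Spherical

/-- The unit sphere `S^d` centred at the origin of Euclidean `(d+1)`-space. -/
abbrev Sph (d : ℕ) : Type := Metric.sphere (0 : EuclideanSpace ℝ (Fin (d + 1))) 1

/-- Spherical (geodesic) distance: the length of the shorter great circular arc joining `x` and
`y` on the unit sphere, that is the angle between `x` and `y`; it is `π` for antipodes. -/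
noncomputable def sdist {d : ℕ} (x y : Sph d) : ℝ :=
  InnerProductGeometry.angle (x : EuclideanSpace ℝ (Fin (d + 1)))
    (y : EuclideanSpace ℝ (Fin (d + 1)))

/-- The closed spherical ball `B_s^d[x, r]`. -/
def sball {d : ℕ} (x : Sph d) (r : ℝ) : Set (Sph d) := {y | sdist x y ≤ r}

/-- `B_s^d[X, r]`, the intersection of the closed balls of radius `r` centred at points of `X`. -/
def sballInter {d : ℕ} (X : Set (Sph d)) (r : ℝ) : Set (Sph d) := ⋂ x ∈ X, sball x r

/-- The spherical diameter (a supremum of numbers lying in `[0, π]`). -/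
noncomputable def sdiam {d : ℕ} (X : Set (Sph d)) : ℝ :=
  sSup {t : ℝ | ∃ x ∈ X, ∃ y ∈ X, t = sdist x y}

/-- `K` is a wide `r`-ball body: `K = B_s^d[X, r]` for some non-empty closed `X` of spherical
diameter at most `r`. -/
def IsWideBallBody {d : ℕ} (r : ℝ) (K : Set (Sph d)) : Prop :=
  ∃ X : Set (Sph d), X.Nonempty ∧ IsClosed X ∧ sdiam X ≤ r ∧ K = sballInter X r

/-- The radii `ρ ∈ (0, π/2]` of the closed balls contained in `K`. -/
def inscribedRadii {d : ℕ} (K : Set (Sph d)) : Set ℝ :=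
  {ρ : ℝ | 0 < ρ ∧ ρ ≤ Real.pi / 2 ∧ ∃ c : Sph d, sball c ρ ⊆ K}

/-- The inradius of `K`: the radius of a largest closed ball contained in `K`. -/
noncomputable def inradius {d : ℕ} (K : Set (Sph d)) : ℝ := sSup (inscribedRadii K)

/-- `v 0, …, v d` are the vertices of a regular spherical `d`-simplex of edge length `r`. -/
def IsRegularSimplex {d : ℕ} (v : Fin (d + 1) → Sph d) (r : ℝ) : Prop :=
  LinearIndependent ℝ (fun i => (v i : EuclideanSpace ℝ (Fin (d + 1)))) ∧
    ∀ i j, i ≠ j → sdist (v i) (v j) = r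

/-- `Δ_d(r)` for the regular simplex with vertices `v 0, …, v d`: the intersection of the `d + 1`
closed balls of radius `r` centred at the vertices. -/
def Delta {d : ℕ} (v : Fin (d + 1) → Sph d) (r : ℝ) : Set (Sph d) := ⋂ i, sball (v i) r

end Spherical

open scoped RealInnerProductSpace

namespace Spherical

variable {d : ℕ}

/-! For radii at most `π / 2`, a ball about `c` of radius `ρ` lies in the ball of radius `r` about
`x` exactly when `sdist x c + ρ ≤ r`. So the inradius of `sballInter X r` is `r` minus the
circumradius of `X`, and the claim becomes Jung's theorem on the sphere: among sets of diameter at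
most `r`, the regular simplex has the largest circumradius, `jungRadius d r`. The upper bound
(`exists_forall_le_inner_of_finite`) takes the point `p` of the convex hull nearest to the origin
and projects it to the sphere; the bound is attained by simplex vertices
(`exists_jungRadius_le_sdist`) by averaging inner products. -/

lemma norm_coe (x : Sph d) : ‖(x : EuclideanSpace ℝ (Fin (d + 1)))‖ = 1 := by
  simp

lemma inner_coe_eq_cos (x y : Sph d) :
    ⟪(x : EuclideanSpace ℝ (Fin (d + 1))), y⟫ = Real.cos (sdist x y) :=
  InnerProductGeometry.inner_eq_cos_angle_of_norm_eq_one (norm_coe x) (norm_coe y)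

lemma sdist_nonneg (x y : Sph d) : 0 ≤ sdist x y := InnerProductGeometry.angle_nonneg _ _

lemma sdist_le_pi (x y : Sph d) : sdist x y ≤ Real.pi := InnerProductGeometry.angle_le_pi _ _

lemma sdist_triangle (x y z : Sph d) : sdist x z ≤ sdist x y + sdist y z :=
  InnerProductGeometry.angle_le_angle_add_angle _ _ _

lemma sdist_eq_arccos (x y : Sph d) :
    sdist x y = Real.arccos ⟪(x : EuclideanSpace ℝ (Fin (d + 1))), y⟫ := by
  rw [inner_coe_eq_cos, Real.arccos_cos (sdist_nonneg x y) (sdist_le_pi x y)]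

lemma sdist_self (x : Sph d) : sdist x x = 0 := by
  simp [sdist_eq_arccos]

lemma continuous_sdist_left (x : Sph d) : Continuous fun y : Sph d => sdist x y := by
  simp only [sdist_eq_arccos]
  exact Real.continuous_arccos.comp (continuous_const.inner continuous_subtype_val)

lemma sdist_le_sdiam {X : Set (Sph d)} {x y : Sph d} (hx : x ∈ X) (hy : y ∈ X) :
    sdist x y ≤ sdiam X := by
  refine le_csSup ⟨Real.pi, ?_⟩ ⟨x, hx, y, hy, rfl⟩
  rintro _ ⟨a, -, b, -, rfl⟩
  exact sdist_le_pi a b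

/-! ### Inscribed balls and the inradius -/

lemma exists_unit_orthogonal (hd : 1 ≤ d) (c : EuclideanSpace ℝ (Fin (d + 1))) :
    ∃ u : EuclideanSpace ℝ (Fin (d + 1)), ‖u‖ = 1 ∧ ⟪c, u⟫ = 0 := by
  have hlt : Module.finrank ℝ (ℝ ∙ c) < Module.finrank ℝ (EuclideanSpace ℝ (Fin (d + 1))) := by
    have := finrank_span_le_card (R := ℝ) ({c} : Set (EuclideanSpace ℝ (Fin (d + 1))))
    rw [Set.toFinset_singleton, Finset.card_singleton] at this
    simp only [finrank_euclideanSpace, Fintype.card_fin]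
    omega
  have hne : (ℝ ∙ c)ᗮ ≠ ⊥ := by
    intro h
    rw [Submodule.orthogonal_eq_bot_iff] at h
    rw [h, finrank_top] at hlt
    exact lt_irrefl _ hlt
  obtain ⟨w, hw, hw0⟩ := Submodule.exists_mem_ne_zero_of_ne_bot hne
  refine ⟨‖w‖⁻¹ • w, norm_smul_inv_norm (𝕜 := ℝ) hw0, ?_⟩
  rw [inner_smul_right, Submodule.mem_orthogonal_singleton_iff_inner_right.1 hw, mul_zero]

/-- The great circle arc from `x` to `c` leaves `c` in some unit direction `u`. -/
lemma exists_direction (hd : 1 ≤ d) (x c : Sph d) (h : sdist x c < Real.pi) :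
    ∃ u : EuclideanSpace ℝ (Fin (d + 1)), ‖u‖ = 1 ∧
      ⟪(c : EuclideanSpace ℝ (Fin (d + 1))), u⟫ = 0 ∧
      ⟪(x : EuclideanSpace ℝ (Fin (d + 1))), u⟫ = - Real.sin (sdist x c) := by
  have hcc : ⟪(c : EuclideanSpace ℝ (Fin (d + 1))), c⟫ = 1 := by
    rw [inner_coe_eq_cos, sdist_self, Real.cos_zero]
  have hxx : ⟪(x : EuclideanSpace ℝ (Fin (d + 1))), x⟫ = 1 := by
    rw [inner_coe_eq_cos, sdist_self, Real.cos_zero]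
  have hxc := inner_coe_eq_cos x c
  rcases (sdist_nonneg x c).eq_or_lt with h0 | h0
  · obtain ⟨u, hu, hcu⟩ := exists_unit_orthogonal hd (c : EuclideanSpace ℝ (Fin (d + 1)))
    rw [← h0, Real.cos_zero] at hxc
    rw [inner_eq_one_iff_of_norm_eq_one (norm_coe x) (norm_coe c)] at hxc
    refine ⟨u, hu, hcu, ?_⟩
    rw [hxc, hcu, ← h0]
    simp
  · set θ := sdist x c
    have hs : 0 < Real.sin θ := Real.sin_pos_of_pos_of_lt_pi h0 h
    have hsq := Real.sin_sq_add_cos_sq θ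
    have hcx : ⟪(c : EuclideanSpace ℝ (Fin (d + 1))), x⟫ = Real.cos θ := by
      rw [real_inner_comm, hxc]
    -- The component of `-x` orthogonal to `c`, normalised: its length is `sin θ`.
    refine ⟨(Real.sin θ)⁻¹ • (Real.cos θ • (c : EuclideanSpace ℝ (Fin (d + 1))) - x), ?_, ?_, ?_⟩
    · have hn : ‖Real.cos θ • (c : EuclideanSpace ℝ (Fin (d + 1))) - x‖ ^ 2 = Real.sin θ ^ 2 := by
        rw [← real_inner_self_eq_norm_sq]
        simp only [inner_sub_left, inner_sub_right, inner_smul_left, inner_smul_right, hcc, hxx,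
          hxc, hcx, conj_trivial]
        linarith
      have := (sq_eq_sq₀ (norm_nonneg _) hs.le).1 hn
      rw [norm_smul, this, norm_inv, Real.norm_of_nonneg hs.le, inv_mul_cancel₀ hs.ne']
    · rw [inner_smul_right, inner_sub_right, inner_smul_right, hcc, hcx]
      ring
    · rw [inner_smul_right, inner_sub_right, inner_smul_right, hxx, hxc]
      field_simp
      linarith

/-- A ball lies in a ball of radius at most `π / 2` only if the distance of the centres is at most
the difference of the radii. -/
lemma sdist_add_le_of_sball_subset (hd : 1 ≤ d) {x c : Sph d} {r ρ : ℝ} (hr : r ≤ Real.pi / 2)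
    (hρ0 : 0 ≤ ρ) (hρ : ρ ≤ Real.pi / 2) (h : sball c ρ ⊆ sball x r) : sdist x c + ρ ≤ r := by
  have hpi := Real.pi_pos
  have hxc : sdist x c ≤ r := h (show sdist c c ≤ ρ by rwa [sdist_self])
  obtain ⟨u, hu, hcu, hxu⟩ := exists_direction hd x c (by linarith)
  have huu : ⟪u, u⟫ = 1 := by rw [real_inner_self_eq_norm_sq, hu, one_pow]
  have huc : ⟪u, (c : EuclideanSpace ℝ (Fin (d + 1)))⟫ = 0 := by rw [real_inner_comm, hcu]
  have hcc : ⟪(c : EuclideanSpace ℝ (Fin (d + 1))), c⟫ = 1 := by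
    rw [inner_coe_eq_cos, sdist_self, Real.cos_zero]
  -- Continue the arc from `x` through `c` by a further `ρ`. The total length is at most `π`, so the
  -- distances add.
  let y : Sph d := ⟨Real.cos ρ • (c : EuclideanSpace ℝ (Fin (d + 1))) + Real.sin ρ • u, by
    rw [mem_sphere_zero_iff_norm, ← sq_eq_sq₀ (norm_nonneg _) zero_le_one,
      ← real_inner_self_eq_norm_sq]
    simp only [inner_add_left, inner_add_right, inner_smul_left, inner_smul_right, hcc, huu,
      huc, hcu, conj_trivial]
    linarith [Real.sin_sq_add_cos_sq ρ]⟩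
  have hcy : sdist c y = ρ := by
    rw [sdist_eq_arccos]
    simp only [y, inner_add_right, inner_smul_right, hcc, hcu, mul_one, mul_zero, add_zero]
    exact Real.arccos_cos hρ0 (by linarith)
  have hxy : sdist x y = sdist x c + ρ := by
    rw [sdist_eq_arccos]
    simp only [y, inner_add_right, inner_smul_right, hxu, inner_coe_eq_cos]
    rw [← Real.arccos_cos (x := sdist x c + ρ) (by linarith [sdist_nonneg x c]) (by linarith),
      Real.cos_add]
    congr 1
    ring
  exact hxy ▸ h hcy.le

lemma sball_subset_sballInter {X : Set (Sph d)} {c : Sph d} {r ρ : ℝ}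
    (h : ∀ x ∈ X, sdist x c + ρ ≤ r) : sball c ρ ⊆ sballInter X r := by
  intro y hy
  simp only [sballInter, Set.mem_iInter]
  intro x hx
  exact (sdist_triangle x c y).trans ((add_le_add_right hy _).trans (h x hx))

lemma mem_inscribedRadii_sballInter_iff (hd : 1 ≤ d) {X : Set (Sph d)} {r ρ : ℝ}
    (hr : r ≤ Real.pi / 2) :
    ρ ∈ inscribedRadii (sballInter X r) ↔
      0 < ρ ∧ ρ ≤ Real.pi / 2 ∧ ∃ c : Sph d, ∀ x ∈ X, sdist x c + ρ ≤ r := by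
  refine and_congr_right fun h0 => and_congr_right fun h1 => exists_congr fun c => ⟨?_, ?_⟩
  · intro h x hx
    exact sdist_add_le_of_sball_subset hd hr h0.le h1 (h.trans (Set.biInter_subset_of_mem hx))
  · exact sball_subset_sballInter

lemma bddAbove_inscribedRadii (K : Set (Sph d)) : BddAbove (inscribedRadii K) :=
  ⟨Real.pi / 2, fun _ h => h.2.1⟩

/-- A largest inscribed ball exists as soon as some inscribed ball does. -/
lemma isGreatest_inradius (hd : 1 ≤ d) {X : Set (Sph d)} {r : ℝ} (hr : r ≤ Real.pi / 2)
    (hne : (inscribedRadii (sballInter X r)).Nonempty) :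
    IsGreatest (inscribedRadii (sballInter X r)) (inradius (sballInter X r)) := by
  obtain ⟨ρ₀, hρ₀⟩ := hne
  have hbdd := bddAbove_inscribedRadii (sballInter X r)
  refine ⟨?_, fun ρ h => le_csSup hbdd h⟩
  -- Bounding radii below by `ρ₀` replaces the non-closed condition `0 < ρ`, making the set compact.
  let S : Set (ℝ × Sph d) :=
    (Set.Icc ρ₀ (Real.pi / 2) ×ˢ Set.univ) ∩ ⋂ x ∈ X, {p | sdist x p.2 + p.1 ≤ r}
  have hS : IsCompact S := by
    refine (isCompact_Icc.prod isCompact_univ).inter_right (isClosed_biInter fun x _ => ?_)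
    refine isClosed_le (Continuous.add ?_ continuous_fst) continuous_const
    exact (continuous_sdist_left x).comp continuous_snd
  have hSmem : ∀ p, p ∈ S ↔ ρ₀ ≤ p.1 ∧ p.1 ≤ Real.pi / 2 ∧ ∀ x ∈ X, sdist x p.2 + p.1 ≤ r := by
    intro p
    simp only [S, Set.mem_inter_iff, Set.mem_prod, Set.mem_Icc, Set.mem_univ, and_true,
      Set.mem_iInter, Set.mem_ofPred_eq, and_assoc]
  have hmem : ∀ ρ, ρ ∈ Prod.fst '' S ↔ ρ ∈ inscribedRadii (sballInter X r) ∩ Set.Ici ρ₀ := by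
    intro ρ
    rw [Set.mem_inter_iff, mem_inscribedRadii_sballInter_iff hd hr]
    constructor
    · rintro ⟨p, hp, rfl⟩
      obtain ⟨h1, h2, h3⟩ := (hSmem p).1 hp
      exact ⟨⟨hρ₀.1.trans_le h1, h2, p.2, h3⟩, h1⟩
    · rintro ⟨⟨-, h2, c, h3⟩, h1⟩
      exact ⟨(ρ, c), (hSmem _).2 ⟨h1, h2, h3⟩, rfl⟩
  have hne' : (Prod.fst '' S).Nonempty := ⟨ρ₀, (hmem ρ₀).2 ⟨hρ₀, Set.self_mem_Ici⟩⟩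
  obtain ⟨m, hm, hmax⟩ := (hS.image continuous_fst).exists_isGreatest hne'
  rw [hmem] at hm
  have : inradius (sballInter X r) = m := by
    refine IsGreatest.csSup_eq ⟨hm.1, fun ρ hρ => ?_⟩
    rcases le_total ρ ρ₀ with h | h
    · exact h.trans hm.2
    · exact hmax ((hmem ρ).2 ⟨hρ, h⟩)
  rw [this]
  exact hm.1

/-! ### Jung's theorem -/

/-- The nearest point to the origin of the convex hull of finitely many unit vectors with pairwise
inner products at least `t ≥ 0`. -/
lemma exists_forall_le_inner_of_finite {t : ℝ} (ht0 : 0 ≤ t) (ht1 : t ≤ 1)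
    {A : Set (EuclideanSpace ℝ (Fin (d + 1)))} (hA : A.Finite) (hne : A.Nonempty)
    (hunit : ∀ x ∈ A, ‖x‖ = 1) (hA' : ∀ x ∈ A, ∀ y ∈ A, t ≤ ⟪x, y⟫) :
    ∃ p : EuclideanSpace ℝ (Fin (d + 1)), 0 < ‖p‖ ∧ (1 + d * t) / (d + 1) ≤ ‖p‖ ^ 2 ∧
      ∀ x ∈ A, ‖p‖ ^ 2 ≤ ⟪x, p⟫ := by
  have hconv := convex_convexHull ℝ A
  obtain ⟨p, hp, hmin⟩ := exists_norm_eq_iInf_of_complete_convex (hne.convexHull (𝕜 := ℝ))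
    (hA.isCompact_convexHull ℝ).isComplete hconv 0
  rw [norm_eq_iInf_iff_real_inner_le_zero hconv hp] at hmin
  have hge : ∀ x ∈ A, ‖p‖ ^ 2 ≤ ⟪x, p⟫ := by
    intro x hx
    have := hmin x (subset_convexHull ℝ A hx)
    rw [zero_sub, inner_neg_left, inner_sub_right, real_inner_self_eq_norm_sq,
      real_inner_comm] at this
    linarith
  -- Carathéodory: affinely independent points with positive weights.
  obtain ⟨ι, _, z, w, hz, haff, hw0, hw1, hwz⟩ := eq_pos_convex_span_of_mem_convexHull hp
  have hzA : ∀ i, z i ∈ A := fun i => hz ⟨i, rfl⟩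
  have hpp : ‖p‖ ^ 2 = ∑ i, w i * ⟪z i, p⟫ := by
    rw [← real_inner_self_eq_norm_sq]
    nth_rw 1 [← hwz]
    simp only [sum_inner, inner_smul_left, conj_trivial]
  have hzp : ∀ i, t + (1 - t) * w i ≤ ⟪z i, p⟫ := by
    classical
    intro i
    have h1 : ⟪z i, p⟫ = ∑ j, w j * ⟪z i, z j⟫ := by
      rw [← hwz]
      simp only [inner_sum, inner_smul_right]
    have h2 : t + (1 - t) * w i = ∑ j, (w j * t + if j = i then (1 - t) * w j else 0) := by
      rw [Finset.sum_add_distrib, ← Finset.sum_mul, hw1]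
      simp
    rw [h1, h2]
    refine Finset.sum_le_sum fun j _ => ?_
    split_ifs with hji
    · subst hji
      rw [real_inner_self_eq_norm_sq, hunit _ (hzA j)]
      linarith
    · rw [add_zero]
      exact mul_le_mul_of_nonneg_left (hA' _ (hzA i) _ (hzA j)) (hw0 j).le
  have hlow : t + (1 - t) * ∑ i, w i ^ 2 ≤ ‖p‖ ^ 2 := by
    have h2 : t + (1 - t) * ∑ i, w i ^ 2 = ∑ i, w i * (t + (1 - t) * w i) := by
      have : ∀ i, w i * (t + (1 - t) * w i) = w i * t + (1 - t) * w i ^ 2 := fun i => by ring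
      simp only [this]
      rw [Finset.sum_add_distrib, ← Finset.sum_mul, hw1, Finset.mul_sum, one_mul]
    rw [hpp, h2]
    exact Finset.sum_le_sum fun i _ => mul_le_mul_of_nonneg_left (hzp i) (hw0 i).le
  have hcs : 1 ≤ (Fintype.card ι : ℝ) * ∑ i, w i ^ 2 := by
    have := sq_sum_le_card_mul_sum_sq (s := Finset.univ) (f := w)
    rwa [hw1, one_pow, Finset.card_univ] at this
  have hsum : 0 < ∑ i, w i ^ 2 := by
    by_contra! hle
    nlinarith [(Nat.cast_nonneg (Fintype.card ι) : (0 : ℝ) ≤ _)]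
  have hp0 : 0 < ‖p‖ ^ 2 := by
    rcases ht0.eq_or_lt with h | h
    · subst h; linarith
    · nlinarith
  -- Points of positive weight lie on the supporting hyperplane at `p`. It misses the origin, so
  -- affine independence becomes linear independence, giving at most `d + 1` points instead of `d +
  -- 2`.
  have heq : ∀ i, ⟪z i, p⟫ = ‖p‖ ^ 2 := by
    have hs : ∑ i, w i * (⟪z i, p⟫ - ‖p‖ ^ 2) = 0 := by
      simp only [mul_sub, Finset.sum_sub_distrib]
      rw [← hpp, ← Finset.sum_mul, hw1]
      ring
    rw [Finset.sum_eq_zero_iff_of_nonneg fun i _ =>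
      mul_nonneg (hw0 i).le (sub_nonneg.2 (hge _ (hzA i)))] at hs
    intro i
    have := (mul_eq_zero.1 (hs i (Finset.mem_univ i))).resolve_left (hw0 i).ne'
    linarith
  have hlin : LinearIndependent ℝ z := by
    rw [Fintype.linearIndependent_iff]
    intro g hg
    have hg0 : ∑ i, g i = 0 := by
      have h1 : ⟪∑ i, g i • z i, p⟫ = (∑ i, g i) * ‖p‖ ^ 2 := by
        simp only [sum_inner, inner_smul_left, conj_trivial, heq, Finset.sum_mul]
      rw [hg, inner_zero_left] at h1
      exact (mul_eq_zero.1 h1.symm).resolve_right hp0.ne'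
    exact fun i => affineIndependent_iff.1 haff Finset.univ g hg0 hg i (Finset.mem_univ i)
  have hcard : (Fintype.card ι : ℝ) ≤ d + 1 := by
    have := hlin.fintype_card_le_finrank
    rw [finrank_euclideanSpace, Fintype.card_fin] at this
    exact_mod_cast this
  refine ⟨p, ?_, ?_, hge⟩
  · by_contra! h
    have : ‖p‖ = 0 := le_antisymm h (norm_nonneg _)
    simp [this] at hp0
  · have hd1 : (0 : ℝ) < d + 1 := by positivity
    have h1 : 1 ≤ ((d : ℝ) + 1) * ∑ i, w i ^ 2 :=
      hcs.trans (mul_le_mul_of_nonneg_right hcard hsum.le)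
    rw [div_le_iff₀ hd1]
    nlinarith [mul_le_mul_of_nonneg_left h1 (sub_nonneg.2 ht1)]

/-- The circumradius of a regular spherical `d`-simplex of edge length `r`. -/
noncomputable def jungRadius (d : ℕ) (r : ℝ) : ℝ :=
  Real.arccos √((1 + d * Real.cos r) / (d + 1))

lemma exists_forall_sdist_le_jungRadius_of_finite {r : ℝ} (hr0 : 0 ≤ r) (hr : r ≤ Real.pi / 2)
    {X : Set (Sph d)} (hfin : X.Finite) (hne : X.Nonempty)
    (hX : ∀ x ∈ X, ∀ y ∈ X, sdist x y ≤ r) :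
    ∃ c : Sph d, ∀ x ∈ X, sdist x c ≤ jungRadius d r := by
  have hpi := Real.pi_pos
  have hcos : 0 ≤ Real.cos r := Real.cos_nonneg_of_neg_pi_div_two_le_of_le (by linarith) hr
  have hunit : ∀ x ∈ ((↑) '' X : Set (EuclideanSpace ℝ (Fin (d + 1)))), ‖x‖ = 1 := by
    rintro _ ⟨x, -, rfl⟩
    exact norm_coe x
  have hinner : ∀ x ∈ ((↑) '' X : Set (EuclideanSpace ℝ (Fin (d + 1)))),
      ∀ y ∈ ((↑) '' X : Set (EuclideanSpace ℝ (Fin (d + 1)))), Real.cos r ≤ ⟪x, y⟫ := by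
    rintro _ ⟨x, hx, rfl⟩ _ ⟨y, hy, rfl⟩
    rw [inner_coe_eq_cos]
    exact Real.cos_le_cos_of_nonneg_of_le_pi (sdist_nonneg _ _) (by linarith) (hX x hx y hy)
  obtain ⟨p, hp0, hp, hpx⟩ := exists_forall_le_inner_of_finite hcos (Real.cos_le_one r)
    (hfin.image _) (hne.image _) hunit hinner
  have hc : ‖‖p‖⁻¹ • p‖ = 1 := by
    rw [norm_smul, norm_inv, norm_norm, inv_mul_cancel₀ hp0.ne']
  refine ⟨⟨‖p‖⁻¹ • p, mem_sphere_zero_iff_norm.2 hc⟩, fun x hx => ?_⟩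
  rw [sdist_eq_arccos, jungRadius]
  refine Real.arccos_le_arccos (((Real.sqrt_le_left hp0.le).2 hp).trans ?_)
  rw [inner_smul_right, inv_mul_eq_div, le_div_iff₀ hp0, ← sq]
  exact hpx _ ⟨x, hx, rfl⟩

/-- Jung's theorem on the sphere, for sets of diameter at most `π / 2`. -/
theorem exists_forall_sdist_le_jungRadius {r : ℝ} (hr0 : 0 ≤ r) (hr : r ≤ Real.pi / 2)
    {X : Set (Sph d)} (hne : X.Nonempty) (hX : ∀ x ∈ X, ∀ y ∈ X, sdist x y ≤ r) :
    ∃ c : Sph d, ∀ x ∈ X, sdist x c ≤ jungRadius d r := by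
  -- Admissible centres form closed sets in a compact sphere, so finite subsets suffice.
  have hclosed : ∀ x : X, IsClosed {c : Sph d | sdist (x : Sph d) c ≤ jungRadius d r} := fun x =>
    isClosed_le (continuous_sdist_left (x : Sph d)) continuous_const
  have hfip : ∀ u : Finset X,
      (Set.univ ∩ ⋂ x ∈ u, {c : Sph d | sdist (x : Sph d) c ≤ jungRadius d r}).Nonempty := by
    intro u
    rw [Set.univ_inter]
    rcases u.eq_empty_or_nonempty with rfl | hu
    · obtain ⟨x, -⟩ := hne
      exact ⟨x, by simp⟩
    · obtain ⟨c, hc⟩ := exists_forall_sdist_le_jungRadius_of_finite (d := d) hr0 hr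
        (X := Subtype.val '' (u : Set X)) (u.finite_toSet.image _) (Set.Nonempty.image _ hu) (by
          rintro _ ⟨x, -, rfl⟩ _ ⟨y, -, rfl⟩
          exact hX x x.2 y y.2)
      exact ⟨c, Set.mem_iInter₂.2 fun x hx => hc x ⟨x, hx, rfl⟩⟩
  obtain ⟨c, -, hc⟩ := isCompact_univ.inter_iInter_nonempty _ hclosed hfip
  exact ⟨c, fun x hx => Set.mem_iInter.1 hc ⟨x, hx⟩⟩

lemma jungRadius_nonneg (d : ℕ) (r : ℝ) : 0 ≤ jungRadius d r := Real.arccos_nonneg _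

lemma jungRadius_lt {r : ℝ} (hr0 : 0 < r) (hr : r ≤ Real.pi / 2) : jungRadius d r < r := by
  have hpi := Real.pi_pos
  have hcos : 0 ≤ Real.cos r := Real.cos_nonneg_of_neg_pi_div_two_le_of_le (by linarith) hr
  have hcos1 : Real.cos r < 1 := by
    rw [← Real.cos_zero]
    exact Real.cos_lt_cos_of_nonneg_of_le_pi le_rfl (by linarith) hr0
  have hd1 : (0 : ℝ) < d + 1 := by positivity
  have hlt : Real.cos r < √((1 + d * Real.cos r) / (d + 1)) := by
    refine Real.lt_sqrt_of_sq_lt ?_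
    rw [lt_div_iff₀ hd1]
    have : 0 < (1 - Real.cos r) * (1 + (d + 1) * Real.cos r) :=
      mul_pos (by linarith) (by positivity)
    nlinarith
  have hle : √((1 + d * Real.cos r) / (d + 1)) ≤ 1 := by
    rw [Real.sqrt_le_one, div_le_one hd1]
    nlinarith [(Nat.cast_nonneg d : (0 : ℝ) ≤ d)]
  calc jungRadius d r < Real.arccos (Real.cos r) :=
        Real.arccos_lt_arccos (by linarith) hlt hle
    _ = r := Real.arccos_cos hr0.le (by linarith)

/-! ### Regular simplices -/

/-- No point is closer than the circumradius to all vertices of a regular simplex. -/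
lemma exists_jungRadius_le_sdist {r : ℝ} {v : Fin (d + 1) → Sph d}
    (hv : IsRegularSimplex v r) (c : Sph d) : ∃ i, jungRadius d r ≤ sdist (v i) c := by
  have hd1 : (0 : ℝ) < d + 1 := by positivity
  set p : EuclideanSpace ℝ (Fin (d + 1)) := ∑ i, (v i : EuclideanSpace ℝ (Fin (d + 1)))
  have hin : ∀ i, ⟪(v i : EuclideanSpace ℝ (Fin (d + 1))), p⟫ = 1 + d * Real.cos r := by
    intro i
    have h1 : ∀ j, ⟪(v i : EuclideanSpace ℝ (Fin (d + 1))), v j⟫ =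
        Real.cos r + if j = i then 1 - Real.cos r else 0 := by
      intro j
      rw [inner_coe_eq_cos]
      split_ifs with h
      · rw [h, sdist_self, Real.cos_zero]; ring
      · rw [hv.2 i j (Ne.symm h), add_zero]
    simp only [p, inner_sum, h1, Finset.sum_add_distrib, Finset.sum_const, Finset.card_univ,
      Fintype.card_fin, Finset.sum_ite_eq', Finset.mem_univ, if_true, nsmul_eq_mul]
    push_cast
    ring
  have hp : ‖p‖ ^ 2 = (d + 1) * (1 + d * Real.cos r) := by
    rw [← real_inner_self_eq_norm_sq]
    nth_rw 1 [show p = ∑ i, (v i : EuclideanSpace ℝ (Fin (d + 1))) from rfl]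
    rw [sum_inner]
    simp only [hin, Finset.sum_const, Finset.card_univ, Fintype.card_fin, nsmul_eq_mul]
    push_cast
    ring
  have hsqrt : √((1 + d * Real.cos r) / (d + 1)) = ‖p‖ / (d + 1) := by
    rw [← Real.sqrt_sq (div_nonneg (norm_nonneg p) hd1.le), div_pow, hp]
    congr 1
    field_simp
  -- Cauchy–Schwarz bounds the average inner product of the vertices with `c`; some vertex is at
  -- most average.
  have hsum : ∑ i, ⟪(v i : EuclideanSpace ℝ (Fin (d + 1))), c⟫ ≤
      ∑ _i : Fin (d + 1), ‖p‖ / (d + 1) := by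
    rw [← sum_inner, Finset.sum_const, Finset.card_univ, Fintype.card_fin, nsmul_eq_mul]
    push_cast
    rw [mul_div_cancel₀ _ hd1.ne']
    simpa using real_inner_le_norm p (c : EuclideanSpace ℝ (Fin (d + 1)))
  obtain ⟨i, -, hi⟩ := Finset.exists_le_of_sum_le Finset.univ_nonempty hsum
  refine ⟨i, ?_⟩
  rw [sdist_eq_arccos, jungRadius, hsqrt]
  exact Real.arccos_le_arccos hi

lemma Delta_eq_sballInter (v : Fin (d + 1) → Sph d) (r : ℝ) :
    Delta v r = sballInter (Set.range v) r := by
  simp [Delta, sballInter]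

lemma IsRegularSimplex.sdist_le {v : Fin (d + 1) → Sph d} {r : ℝ} (hv : IsRegularSimplex v r)
    (hr0 : 0 ≤ r) (i j : Fin (d + 1)) : sdist (v i) (v j) ≤ r := by
  rcases eq_or_ne i j with rfl | h
  · rwa [sdist_self]
  · exact (hv.2 i j h).le

lemma isWideBallBody_Delta {v : Fin (d + 1) → Sph d} {r : ℝ} (hv : IsRegularSimplex v r)
    (hr0 : 0 ≤ r) : IsWideBallBody r (Delta v r) := by
  refine ⟨Set.range v, Set.range_nonempty v, (Set.finite_range v).isClosed, ?_,
    Delta_eq_sballInter v r⟩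
  refine csSup_le ⟨_, v 0, ⟨0, rfl⟩, v 0, ⟨0, rfl⟩, rfl⟩ ?_
  rintro _ ⟨_, ⟨i, rfl⟩, _, ⟨j, rfl⟩, rfl⟩
  exact hv.sdist_le hr0 i j

/-- The vertices are `a • eᵢ + b • (1, …, 1)`; `a` fixes the gap between diagonal and off-diagonal
inner products, `b` the off-diagonal value. -/
lemma exists_isRegularSimplex (d : ℕ) {r : ℝ} (hr0 : 0 < r) (hr : r ≤ Real.pi / 2) :
    ∃ v : Fin (d + 1) → Sph d, IsRegularSimplex v r := by
  have hpi := Real.pi_pos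
  have hcos : 0 ≤ Real.cos r := Real.cos_nonneg_of_neg_pi_div_two_le_of_le (by linarith) hr
  have hcos1 : Real.cos r < 1 := by
    rw [← Real.cos_zero]
    exact Real.cos_lt_cos_of_nonneg_of_le_pi le_rfl (by linarith) hr0
  have hd1 : (0 : ℝ) < d + 1 := by positivity
  obtain ⟨a, ha, ha2⟩ : ∃ a : ℝ, 0 < a ∧ a ^ 2 = 1 - Real.cos r :=
    ⟨√(1 - Real.cos r), Real.sqrt_pos.2 (by linarith), Real.sq_sqrt (by linarith)⟩
  obtain ⟨b, hb, hb2⟩ : ∃ b : ℝ, 0 ≤ b ∧ (d + 1) * b ^ 2 + 2 * a * b = Real.cos r := by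
    have hs := Real.sq_sqrt (show 0 ≤ a ^ 2 + (d + 1) * Real.cos r by positivity)
    have hle : a ≤ √(a ^ 2 + (d + 1) * Real.cos r) :=
      Real.le_sqrt_of_sq_le (le_add_of_nonneg_right (by positivity))
    refine ⟨(√(a ^ 2 + (d + 1) * Real.cos r) - a) / (d + 1),
      div_nonneg (sub_nonneg.2 hle) hd1.le, ?_⟩
    field_simp
    linarith
  let e : Fin (d + 1) → EuclideanSpace ℝ (Fin (d + 1)) := fun i =>
    WithLp.toLp 2 fun k => (if k = i then a else 0) + b
  have he : ∀ i j, ⟪e i, e j⟫ = Real.cos r + if i = j then 1 - Real.cos r else 0 := by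
    intro i j
    have h1 : ∀ k, ((if k = j then a else 0) + b) * ((if k = i then a else 0) + b) =
        (if k = j then (if j = i then a ^ 2 else 0) + a * b else 0) +
          (if k = i then a * b else 0) + b ^ 2 := by
      intro k
      by_cases hi : k = i
      · subst hi
        by_cases hj : k = j
        · subst hj; simp; ring
        · simp [hj]; ring
      · by_cases hj : k = j
        · subst hj; simp [hi]; ring
        · simp [hi, hj]; ring
    simp only [e, PiLp.inner_apply, RCLike.inner_apply, conj_trivial, h1,
      Finset.sum_add_distrib, Finset.sum_ite_eq', Finset.mem_univ, if_true, Finset.sum_const,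
      Finset.card_univ, Fintype.card_fin, nsmul_eq_mul]
    rw [← ha2, ← hb2]
    push_cast
    by_cases hij : i = j
    · subst hij; simp; ring
    · simp [hij, Ne.symm hij]; ring
  let v : Fin (d + 1) → Sph d := fun i => ⟨e i, by
    rw [mem_sphere_zero_iff_norm, ← sq_eq_sq₀ (norm_nonneg _) zero_le_one,
      ← real_inner_self_eq_norm_sq, he]
    simp⟩
  refine ⟨v, ?_, fun i j hij => ?_⟩
  · rw [Fintype.linearIndependent_iff]
    intro g hg
    have hk : ∀ k, g k * a + (∑ i, g i) * b = 0 := by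
      intro k
      have := congrArg (fun x : EuclideanSpace ℝ (Fin (d + 1)) => x k) hg
      simpa [v, e, mul_add, Finset.sum_add_distrib, Finset.sum_mul] using this
    have hs : (∑ i, g i) * (a + (d + 1) * b) = 0 := by
      have := Finset.sum_eq_zero (s := Finset.univ) fun k _ => hk k
      rw [Finset.sum_add_distrib, ← Finset.sum_mul, Finset.sum_const, Finset.card_univ,
        Fintype.card_fin, nsmul_eq_mul] at this
      push_cast at this
      linarith
    have hs0 := (mul_eq_zero.1 hs).resolve_right (by positivity)
    intro k
    have := hk k
    rw [hs0, zero_mul, add_zero] at this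
    exact (mul_eq_zero.1 this).resolve_right ha.ne'
  · rw [sdist_eq_arccos]
    change Real.arccos ⟪e i, e j⟫ = r
    rw [he, if_neg hij, add_zero, Real.arccos_cos hr0.le (by linarith)]

lemma sub_jungRadius_mem_inscribedRadii {r : ℝ} (hr0 : 0 < r) (hr : r ≤ Real.pi / 2)
    {X : Set (Sph d)} (hne : X.Nonempty) (hX : sdiam X ≤ r) :
    r - jungRadius d r ∈ inscribedRadii (sballInter X r) := by
  obtain ⟨c, hc⟩ := exists_forall_sdist_le_jungRadius hr0.le hr hne
    fun x hx y hy => (sdist_le_sdiam hx hy).trans hX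
  refine ⟨sub_pos.2 (jungRadius_lt hr0 hr), by linarith [jungRadius_nonneg d r], c,
    sball_subset_sballInter fun x hx => ?_⟩
  linarith [hc x hx]

lemma inradius_Delta_le (hd : 1 ≤ d) {r : ℝ} (hr0 : 0 < r) (hr : r ≤ Real.pi / 2)
    {v : Fin (d + 1) → Sph d} (hv : IsRegularSimplex v r) :
    inradius (Delta v r) ≤ r - jungRadius d r := by
  -- The bound must be nonnegative since `sSup ∅ = 0`.
  refine Real.sSup_le (fun ρ hρ => ?_) (sub_nonneg.2 (jungRadius_lt hr0 hr).le)
  rw [Delta_eq_sballInter, mem_inscribedRadii_sballInter_iff hd hr] at hρ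
  obtain ⟨-, -, c, hc⟩ := hρ
  obtain ⟨i, hi⟩ := exists_jungRadius_le_sdist hv c
  linarith [hc _ ⟨i, rfl⟩]

end Spherical

theorem proposition2 (d : ℕ) (hd : 2 ≤ d) (r : ℝ) (hr0 : 0 < r) (hr : r ≤ Real.pi / 2) :
    -- regular spherical `d`-simplices of edge length `r` exist, and for each of them
    (∃ v : Fin (d + 1) → Spherical.Sph d, Spherical.IsRegularSimplex v r) ∧
    ∀ v : Fin (d + 1) → Spherical.Sph d, Spherical.IsRegularSimplex v r →
      -- `Δ_d(r)` is a wide `r`-ball body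
      Spherical.IsWideBallBody r (Spherical.Delta v r) ∧
      -- and every wide `r`-ball body has a largest inscribed ball, no smaller than `Δ_d(r)` has
      ∀ K : Set (Spherical.Sph d), Spherical.IsWideBallBody r K →
        IsGreatest (Spherical.inscribedRadii K) (Spherical.inradius K) ∧
        Spherical.inradius (Spherical.Delta v r) ≤ Spherical.inradius K := by
  have hd1 : 1 ≤ d := by omega
  refine ⟨Spherical.exists_isRegularSimplex d hr0 hr, fun v hv =>
    ⟨Spherical.isWideBallBody_Delta hv hr0.le, ?_⟩⟩
  rintro _ ⟨X, hne, -, hX, rfl⟩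
  have hmem := Spherical.sub_jungRadius_mem_inscribedRadii hr0 hr hne hX
  exact ⟨Spherical.isGreatest_inradius hd1 hr ⟨_, hmem⟩,
    (Spherical.inradius_Delta_le hd1 hr0 hr hv).trans
      (le_csSup (Spherical.bddAbove_inscribedRadii _) hmem)⟩
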